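/- A branching Markov decision process (BMDP) consists of a finite set $P$ of types, a finite set $A$ of actions, a partial function $p$ that assigns to a type $q$ and an action $a$ a finitely supported probability distribution $p(q,a)$ on the set $P^*$ of finite lists of types, and a cost function $c : P\times A\to(0,\infty)$. Let $A(q)$ be the set of actions $a$ for which $p(q,a)$ is defined; assume $A(q)\neq\emptyset$ for every $q\in P$. States are lists $\alpha\in P^*$, whose elements are called entities. In a nonempty state $\alpha$ the controller picks a position $i\le|\alpha|$ and an action $a\in A(\alpha_i)$, pays $c(\alpha_i,a)$, and the entity $\alpha_i$ is replaced in the list by a random list $\beta$ with law $p(\alpha_i,a)$; the empty state is never left and costs nothing. A strategy chooses, after each finite history, a probability distribution on the pairs $(i,a)$ that are available in the current state. Together with an initial state $\alpha$, a strategy $\sigma$ induces a probability measure on infinite runs. Let $\mathrm{ETotal}_*(\alpha,\sigma)\in[0,\infty]$ be the limit as $N\to\infty$ of the expected cost of the first $N$ steps, let $\mathrm{ETotal}_*(\alpha)=\inf_\sigma \mathrm{ETotal}_*(\alpha,\sigma)$ over all strategies, and call $\sigma$ optimal if $\mathrm{ETotal}_*(\alpha,\sigma)=\mathrm{ETotal}_*(\alpha)$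 for every initial state $\alpha$. A strategy is static if there is a function $f:P\to A$ such that in every nonempty state it applies, with probability one, the action $f(q)$ to the first entity, where $q$ is the type of that entity. Let $c^*_q=\mathrm{ETotal}_*(q)$ for $q\in P$ (starting from a single entity of type $q$), and for $x\in[0,\infty]^P$ let $$F_q(x)=\min_{a\in A(q)}\Bigl(c(q,a)+\sum_{\alpha\in P^*}p(q,a)(\alpha)\sum_{i\le|\alpha|}x_{\alpha_i}\Bigr).$$ Corollary. Every BMDP as above has an optimal static strategy. More precisely, there is an optimal static strategy whose function $f$ picks, for each type $q$, an action $f(q)\in A(q)$ attaining the minimum in $F_q(c^*)$; and every static strategy whose function $f$ picks such actions is optimal. -/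

import Mathlib

open MeasureTheory ProbabilityTheory Filter Topology
open scoped ENNReal NNReal

/-- A branching Markov decision process with types `P` and actions `A` (both are required to be
finite where the process is used). The transition function is partial: `trans q a = none` means
that `a` is not available to an entity of type `q`. -/
structure BMDP (P A : Type*) where
  /-- the partial probabilistic transition function `P × A → Dist(P*)` -/
  trans : P → A → Option (PMF (List P))
  /-- all the distributions are finite -/
  finite_support : ∀ q a μ, trans q a = some μ → μ.support.Finite
  /-- the cost function -/
  cost : P → A → ℝ≥0
  /-- all costs are positive -/
  cost_pos : ∀ q a, 0 < cost q a

/-- One entry of a run: a state, and the action that led to it. The action `some (i, a)` applies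
`a` to the entity in position `i` (positions are counted from `0`); `none` is the idle move, the
only one in the empty state, and it also fills the action slot of the initial entry. -/
structure BMDPStep (P A : Type*) where
  /-- the action that led to the state -/
  action : Option (ℕ × A)
  /-- the state, a list of entities -/
  state : List P

namespace BMDPStep

variable {P A : Type*}

/-- A step is the same as a pair. -/
def equivProd : BMDPStep P A ≃ Option (ℕ × A) × List P where
  toFun s := (s.action, s.state)
  invFun s := ⟨s.1, s.2⟩
  left_inv _ := rfl
  right_inv _ := rfl

instance [Countable P] [Countable A] : Countable (BMDPStep P A) :=
  Countable.of_equiv _ equivProd.symm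

instance : MeasurableSpace (BMDPStep P A) := ⊤

instance : DiscreteMeasurableSpace (BMDPStep P A) := ⟨fun _ => trivial⟩

end BMDPStep

/-- Histories with `n` steps: entries number `0, …, n`. -/
abbrev BMDPHistory (P A : Type*) (n : ℕ) : Type _ := Finset.Iic n → BMDPStep P A

/-- The last state of a history. -/
def BMDPHistory.last {P A : Type*} {n : ℕ} (h : BMDPHistory P A n) : List P :=
  (h ⟨n, Finset.mem_Iic.2 le_rfl⟩).state

namespace BMDP

variable {P A : Type*}

/-- The set `A(q)` of the actions available to an entity of type `q`. -/
def avail (B : BMDP P A) (q : P) : Set A := {a | (B.trans q a).isSome}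

/-! ### The semantics: a Markov decision process on lists of entities -/

/-- The partial transition function on states: `(i, a)` replaces the entity in position `i` by its
random offspring under `a`; the empty state only has the idle move, which stays there. -/
noncomputable def stateTrans (B : BMDP P A) (α : List P) :
    Option (ℕ × A) → Option (PMF (List P))
  | none => if α.isEmpty then some (PMF.pure []) else none
  | some (i, a) => (α[i]?).bind fun q => (B.trans q a).map fun μ =>
      μ.map fun β => α.take i ++ β ++ α.drop (i + 1)

/-- The moves available in state `α`. -/
def enabled (B : BMDP P A) (α : List P) : Set (Option (ℕ × A)) :=
  {o | (B.stateTrans α o).isSome}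

/-- The cost of a move in state `α`; the idle move is free. -/
def stateCost (B : BMDP P A) (α : List P) : Option (ℕ × A) → ℝ≥0
  | none => 0
  | some (i, a) => (α[i]?).elim 0 fun q => B.cost q a

/-- Strategies: history dependent and randomised, with only available moves in their support.
They are defined on all histories; those that are not finite paths are visited with
probability zero. -/
structure Strategy (B : BMDP P A) where
  /-- the distribution of the next move after a history -/
  choose : ∀ n, BMDPHistory P A n → PMF (Option (ℕ × A))
  /-- only available moves are chosen -/
  support_subset : ∀ n h, (choose n h).support ⊆ B.enabled h.last

namespace Strategy

variable {B : BMDP P A}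

/-- The distribution of the next entry of the run after a history. The default `PMF.pure h.last`
is never used, as the moves in the support of the strategy are available. -/
noncomputable def next (σ : B.Strategy) (n : ℕ) (h : BMDPHistory P A n) : PMF (BMDPStep P A) :=
  (σ.choose n h).bind fun o =>
    ((B.stateTrans h.last o).getD (PMF.pure h.last)).map fun β => ⟨o, β⟩

/-- `next` as a Markov kernel. -/
noncomputable def kernel [Finite P] [Finite A] (σ : B.Strategy) (n : ℕ) :
    Kernel (BMDPHistory P A n) (BMDPStep P A) where
  toFun h := (σ.next n h).toMeasure
  measurable' := measurable_of_countable _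

instance [Finite P] [Finite A] (σ : B.Strategy) (n : ℕ) : IsMarkovKernel (σ.kernel n) :=
  ⟨fun h => inferInstanceAs (IsProbabilityMeasure (σ.next n h).toMeasure)⟩

/-- The probability measure on runs that `σ` induces from the initial state `α`. -/
noncomputable def runMeasure [Finite P] [Finite A] (σ : B.Strategy) (α : List P) :
    Measure (ℕ → BMDPStep P A) :=
  Kernel.traj (X := fun _ => BMDPStep P A) σ.kernel 0 (fun _ => ⟨none, α⟩)

/-- `σ` is the static strategy given by `f`: in every nonempty state it applies, to the first
entity, the action that `f` assigns to its type. -/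
def IsStaticWith (σ : B.Strategy) (f : P → A) : Prop :=
  ∀ n (h : BMDPHistory P A n) (q : P) (α : List P), h.last = q :: α →
    σ.choose n h = PMF.pure (some (0, f q))

end Strategy

/-! ### Costs -/

/-- The cumulative cost of a run after `N` steps. -/
noncomputable def total (B : BMDP P A) (N : ℕ) (π : ℕ → BMDPStep P A) : ℝ≥0∞ :=
  ∑ i ∈ Finset.range N, (B.stateCost (π i).state (π (i + 1)).action : ℝ≥0∞)

/-- The `N`-step expected total cost. -/
noncomputable def expTotalN [Finite P] [Finite A] (B : BMDP P A) (N : ℕ) (α : List P)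
    (σ : B.Strategy) : ℝ≥0∞ :=
  ∫⁻ π, B.total N π ∂(σ.runMeasure α)

/-- The expected total cost, the limit of the `N`-step expected total costs
(see `tendsto_expTotalN`). -/
noncomputable def expTotal [Finite P] [Finite A] (B : BMDP P A) (α : List P)
    (σ : B.Strategy) : ℝ≥0∞ :=
  ⨆ N, B.expTotalN N α σ

theorem tendsto_expTotalN [Finite P] [Finite A] (B : BMDP P A) (α : List P) (σ : B.Strategy) :
    Tendsto (fun N => B.expTotalN N α σ) atTop (𝓝 (B.expTotal α σ)) := by
  refine tendsto_atTop_iSup fun M N hMN => lintegral_mono fun π => ?_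
  exact Finset.sum_le_sum_of_subset (Finset.range_mono hMN)

/-- The optimal expected total cost from the initial state `α`. -/
noncomputable def optTotal [Finite P] [Finite A] (B : BMDP P A) (α : List P) : ℝ≥0∞ :=
  ⨅ σ : B.Strategy, B.expTotal α σ

/-- `σ` attains the optimal expected total cost from every initial state. -/
def Strategy.IsOptimal [Finite P] [Finite A] {B : BMDP P A} (σ : B.Strategy) : Prop :=
  ∀ α, B.expTotal α σ = B.optTotal α

/-- The vector `c*` of the optimal expected total costs of single entities. -/
noncomputable def optVec [Finite P] [Finite A] (B : BMDP P A) : P → ℝ≥0∞ :=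
  fun q => B.optTotal [q]

/-! ### The fixed point operator -/

/-- `c(q,a) + ∑_α p(q,a)(α) ∑_{i ≤ |α|} x_{α_i}`, for an action `a` available to `q`
(for other actions the sum is empty). -/
noncomputable def actionValue (B : BMDP P A) (x : P → ℝ≥0∞) (q : P) (a : A) : ℝ≥0∞ :=
  B.cost q a +
    (B.trans q a).elim 0 fun μ => ∑' α : List P, μ α * (α.map x).sum

/-- The operator `F`. -/
noncomputable def F (B : BMDP P A) (x : P → ℝ≥0∞) (q : P) : ℝ≥0∞ :=
  ⨅ a ∈ B.avail q, B.actionValue x q a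

/-- `a` is an available action of `q` that attains the minimum in `F` at `x`. -/
def AttainsMin (B : BMDP P A) (x : P → ℝ≥0∞) (q : P) (a : A) : Prop :=
  a ∈ B.avail q ∧ B.actionValue x q a = B.F x q

end BMDP

/-! ### Sums against a probability mass function -/

namespace PMF

variable {α β : Type*}

/-! The optimal cost of a state is `weight B.valueLim`, where `valueLim` is the supremum of the
iterates of `F` on `0`.

Lower bound (`Strategy.weight_le_expTotal`): if `x ≤ F x`, the cost paid so far plus the weight of
the current state never decreases in expectation. For finite `x` the leftover weight is at most a
constant times the expected length, and positive costs bound that length by the expected future cost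
(`Strategy.mul_expState_length_le`), a tail that vanishes when the total is finite. The iterates of
`F` are such `x`; the limit itself may be infinite, so the supremum is taken only afterwards.

Upper bound (`Strategy.IsStaticWith.expTotal_le`): if the chosen actions do not increase `x`, the
same quantity never increases in expectation. This applies to minimising actions at `valueLim`
because `F_valueLim_le`. Hence `c* = valueLim`, and static minimisers meet the lower bound. -/

theorem tsum_bind_mul (p : PMF α) (f : α → PMF β) (g : β → ℝ≥0∞) :
    ∑' b, p.bind f b * g b = ∑' a, p a * ∑' b, f a b * g b := by
  simp_rw [PMF.bind_apply, ← ENNReal.tsum_mul_right, ← ENNReal.tsum_mul_left, mul_assoc]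
  exact ENNReal.tsum_comm

theorem tsum_map_mul (p : PMF α) (f : α → β) (g : β → ℝ≥0∞) :
    ∑' b, p.map f b * g b = ∑' a, p a * g (f a) := by
  rw [PMF.map, tsum_bind_mul]
  simp

theorem tsum_mul_const (p : PMF α) (c : ℝ≥0∞) : ∑' a, p a * c = c := by
  rw [ENNReal.tsum_mul_right, p.tsum_coe, one_mul]

theorem le_tsum_mul (p : PMF α) {c : ℝ≥0∞} {g : α → ℝ≥0∞} (h : ∀ a ∈ p.support, c ≤ g a) :
    c ≤ ∑' a, p a * g a := by
  rw [← tsum_mul_const p c]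
  refine ENNReal.tsum_le_tsum fun a => ?_
  by_cases ha : p a = 0
  · simp [ha]
  · gcongr
    exact h a ((p.mem_support_iff a).2 ha)

theorem tsum_mul_le (p : PMF α) {c : ℝ≥0∞} {g : α → ℝ≥0∞} (h : ∀ a ∈ p.support, g a ≤ c) :
    ∑' a, p a * g a ≤ c := by
  conv_rhs => rw [← tsum_mul_const p c]
  refine ENNReal.tsum_le_tsum fun a => ?_
  by_cases ha : p a = 0
  · simp [ha]
  · gcongr
    exact h a ((p.mem_support_iff a).2 ha)

theorem lintegral_toMeasure_eq_tsum [MeasurableSpace α] [MeasurableSingletonClass α] [Countable α]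
    (p : PMF α) (g : α → ℝ≥0∞) : ∫⁻ a, g a ∂p.toMeasure = ∑' a, p a * g a := by
  rw [lintegral_countable']
  simp_rw [p.toMeasure_apply_singleton _ (measurableSet_singleton _), mul_comm]

end PMF

/-! ### Additive weights of states and the value of one move -/

namespace BMDP

variable {P A : Type*}

/-- The total weight of a state when an entity of type `q` weighs `x q`. -/
noncomputable def weight (x : P → ℝ≥0∞) (α : List P) : ℝ≥0∞ := (α.map x).sum

@[simp] theorem weight_nil (x : P → ℝ≥0∞) : weight x [] = 0 := by simp [weight]

@[simp] theorem weight_cons (x : P → ℝ≥0∞) (q : P) (α : List P) :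
    weight x (q :: α) = x q + weight x α := by simp [weight]

@[simp] theorem weight_append (x : P → ℝ≥0∞) (α β : List P) :
    weight x (α ++ β) = weight x α + weight x β := by simp [weight]

theorem weight_mono {x y : P → ℝ≥0∞} (h : x ≤ y) (α : List P) : weight x α ≤ weight y α := by
  induction α with
  | nil => simp
  | cons q α ih => simpa using add_le_add (h q) ih

theorem weight_le_mul_length {x : P → ℝ≥0∞} {K : ℝ≥0∞} (h : ∀ q, x q ≤ K) (α : List P) :
    weight x α ≤ K * α.length := by
  induction α with
  | nil => simp
  | cons q α ih =>
    rw [weight_cons, List.length_cons, Nat.cast_add, mul_add, add_comm]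
    exact add_le_add ih (by simpa using h q)

theorem weight_iSup {x : ℕ → P → ℝ≥0∞} (hx : Monotone x) (α : List P) :
    weight (fun q => ⨆ n, x n q) α = ⨆ n, weight (x n) α := by
  induction α with
  | nil => simp
  | cons q α ih =>
    simp only [weight_cons, ih]
    exact ENNReal.iSup_add_iSup_of_monotone (fun m n h => hx h q)
      fun m n h => weight_mono (hx h) α

/-- The expected value of `cost + φ (next state)` after the move `o` in state `α`. -/
noncomputable def stepValue (B : BMDP P A) (φ : List P → ℝ≥0∞) (α : List P)
    (o : Option (ℕ × A)) : ℝ≥0∞ :=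
  B.stateCost α o + ∑' β, (B.stateTrans α o).getD (PMF.pure α) β * φ β

theorem eq_nil_of_none_mem_enabled {B : BMDP P A} {α : List P} (h : none ∈ B.enabled α) :
    α = [] := by
  by_contra hα
  simp [enabled, stateTrans, hα] at h

theorem exists_of_some_mem_enabled {B : BMDP P A} {α : List P} {i : ℕ} {a : A}
    (h : some (i, a) ∈ B.enabled α) :
    ∃ q μ, α[i]? = some q ∧ B.trans q a = some μ := by
  rw [enabled, Set.mem_ofPred_eq, Option.isSome_iff_exists] at h
  obtain ⟨ν, hν⟩ := h
  simp only [stateTrans, Option.bind_eq_some_iff, Option.map_eq_some_iff] at hν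
  obtain ⟨q, hq, μ, hμ, -⟩ := hν
  exact ⟨q, μ, hq, hμ⟩

theorem stepValue_none_nil (B : BMDP P A) (φ : List P → ℝ≥0∞) :
    B.stepValue φ [] none = φ [] := by
  simp [stepValue, stateCost, stateTrans]

theorem stepValue_some (B : BMDP P A) (φ : List P → ℝ≥0∞) {α : List P} {i : ℕ} {a : A} {q : P}
    {μ : PMF (List P)} (hq : α[i]? = some q) (hμ : B.trans q a = some μ) :
    B.stepValue φ α (some (i, a)) =
      B.cost q a + ∑' β, μ β * φ (α.take i ++ β ++ α.drop (i + 1)) := by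
  simp only [stepValue, stateCost, stateTrans, hq, hμ, Option.bind_some, Option.map_some,
    Option.getD_some, Option.elim_some, PMF.tsum_map_mul]

theorem eq_take_append_cons_drop {α : List P} {i : ℕ} {q : P} (hq : α[i]? = some q) :
    α = α.take i ++ q :: α.drop (i + 1) := by
  obtain ⟨hi, rfl⟩ := List.getElem?_eq_some_iff.1 hq
  simp

/-- Weights are additive and the other entities stay put, so a move affects only the summand of the
chosen entity. This reduces list dynamics to the operator `F` on types. -/
theorem stepValue_weight (B : BMDP P A) (x : P → ℝ≥0∞) {α : List P} {i : ℕ} {a : A} {q : P}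
    {μ : PMF (List P)} (hq : α[i]? = some q) (hμ : B.trans q a = some μ) :
    B.stepValue (weight x) α (some (i, a)) =
      weight x (α.take i) + B.actionValue x q a + weight x (α.drop (i + 1)) := by
  rw [stepValue_some B _ hq hμ, actionValue, hμ]
  simp only [weight_append, mul_add, ENNReal.tsum_add, PMF.tsum_mul_const, Option.elim_some]
  simp only [weight]
  ring

theorem weight_eq_of_getElem? (x : P → ℝ≥0∞) {α : List P} {i : ℕ} {q : P}
    (hq : α[i]? = some q) :
    weight x α = weight x (α.take i) + x q + weight x (α.drop (i + 1)) := by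
  conv_lhs => rw [eq_take_append_cons_drop hq]
  rw [weight_append, weight_cons, add_assoc]

theorem F_le_actionValue (B : BMDP P A) (x : P → ℝ≥0∞) {q : P} {a : A} (ha : a ∈ B.avail q) :
    B.F x q ≤ B.actionValue x q a := iInf₂_le a ha

theorem weight_le_stepValue {B : BMDP P A} {x : P → ℝ≥0∞} (hx : x ≤ B.F x) {α : List P}
    {o : Option (ℕ × A)} (ho : o ∈ B.enabled α) :
    weight x α ≤ B.stepValue (weight x) α o := by
  rcases o with _ | ⟨i, a⟩
  · obtain rfl := eq_nil_of_none_mem_enabled ho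
    simp
  · obtain ⟨q, μ, hq, hμ⟩ := exists_of_some_mem_enabled ho
    rw [stepValue_weight B x hq hμ, weight_eq_of_getElem? x hq]
    gcongr
    exact (hx q).trans (B.F_le_actionValue x (by simp [avail, hμ]))

/-- A move in a nonempty state costs at least `c` and shortens the list by at most one. The
truncation counts the remaining steps, so that iteration ends at the trivial bound `0`. -/
theorem mul_min_length_le_stepValue {B : BMDP P A} {c : ℝ≥0} (hc : ∀ q a, c ≤ B.cost q a) (m : ℕ)
    {α : List P} {o : Option (ℕ × A)} (ho : o ∈ B.enabled α) :
    (c : ℝ≥0∞) * (min (m + 1) α.length : ℕ) ≤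
      B.stepValue (fun β => c * (min m β.length : ℕ)) α o := by
  rcases o with _ | ⟨i, a⟩
  · obtain rfl := eq_nil_of_none_mem_enabled ho
    simp
  · obtain ⟨q, μ, hq, hμ⟩ := exists_of_some_mem_enabled ho
    -- Total mass one moves the cost under the sum, leaving a comparison for each offspring list.
    rw [stepValue_some B _ hq hμ, ← μ.tsum_mul_const (B.cost q a : ℝ≥0∞), ← ENNReal.tsum_add]
    simp_rw [← mul_add]
    refine μ.le_tsum_mul fun β _ => ?_
    have hlen : min (m + 1) α.length ≤ 1 + min m (α.take i ++ β ++ α.drop (i + 1)).length := by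
      have := congrArg List.length (eq_take_append_cons_drop hq)
      simp only [List.length_append, List.length_cons] at this ⊢
      omega
    calc (c : ℝ≥0∞) * (min (m + 1) α.length : ℕ)
        ≤ c * ((1 + min m (α.take i ++ β ++ α.drop (i + 1)).length : ℕ) : ℝ≥0∞) := by gcongr
      _ = c + c * (min m (α.take i ++ β ++ α.drop (i + 1)).length : ℕ) := by
        rw [Nat.cast_add, Nat.cast_one, mul_add, mul_one]
      _ ≤ _ := by
        gcongr
        exact hc q a

/-! ### One step of the run -/

section Run

variable [Finite P] [Finite A] {B : BMDP P A}

theorem Strategy.lintegral_kernel (σ : B.Strategy) (n : ℕ) (h : BMDPHistory P A n)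
    (g : BMDPStep P A → ℝ≥0∞) :
    ∫⁻ y, g y ∂σ.kernel n h = ∑' o, σ.choose n h o *
      ∑' β, (B.stateTrans h.last o).getD (PMF.pure h.last) β * g ⟨o, β⟩ := by
  change ∫⁻ y, g y ∂(σ.next n h).toMeasure = _
  rw [PMF.lintegral_toMeasure_eq_tsum, Strategy.next, PMF.tsum_bind_mul]
  simp_rw [PMF.tsum_map_mul]

/-- The tower property: the law of the history up to `n` together with the next entry is the
composition of the history's law with the kernel. -/
theorem Strategy.lintegral_runMeasure_step (σ : B.Strategy) (α : List P) (n : ℕ)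
    (G : List P → BMDPStep P A → ℝ≥0∞) :
    ∫⁻ π, G (π n).state (π (n + 1)) ∂σ.runMeasure α =
      ∫⁻ π, ∫⁻ y, G (π n).state y ∂σ.kernel n (Preorder.frestrictLe n π) ∂σ.runMeasure α := by
  have hΦ : Measurable fun z : BMDPHistory P A n × BMDPStep P A => G z.1.last z.2 :=
    measurable_of_countable _
  have hf : Measurable (Preorder.frestrictLe (π := fun _ : ℕ => BMDPStep P A) n) := by fun_prop
  have key := Kernel.partialTraj_compProd_eq_map_traj (X := fun _ => BMDPStep P A)
    (κ := σ.kernel) (Nat.zero_le n) (x₀ := fun _ => ⟨none, α⟩)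
  have h := congrArg (fun ν => ∫⁻ z, G (BMDPHistory.last z.1) z.2 ∂ν) key
  rw [lintegral_map hΦ (by fun_prop), Measure.lintegral_compProd hΦ,
    ← Kernel.traj_map_frestrictLe_apply, lintegral_map (measurable_of_countable _) hf] at h
  exact h.symm

/-- The expected cost of step number `n`. -/
noncomputable def Strategy.expCost (σ : B.Strategy) (α : List P) (n : ℕ) : ℝ≥0∞ :=
  ∫⁻ π, (B.stateCost (π n).state (π (n + 1)).action : ℝ≥0∞) ∂σ.runMeasure α

/-- The expected value of `φ` at the state with number `n`. -/
noncomputable def Strategy.expState (σ : B.Strategy) (α : List P) (φ : List P → ℝ≥0∞) (n : ℕ) :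
    ℝ≥0∞ :=
  ∫⁻ π, φ (π n).state ∂σ.runMeasure α

theorem measurable_comp_eval {β : Type*} [MeasurableSpace β] (n : ℕ) (g : BMDPStep P A → β) :
    Measurable fun π : ℕ → BMDPStep P A => g (π n) :=
  (measurable_of_countable g).comp (measurable_pi_apply n)

theorem measurable_stateCost (n : ℕ) : Measurable fun π : ℕ → BMDPStep P A =>
    (B.stateCost (π n).state (π (n + 1)).action : ℝ≥0∞) := by
  have : Measurable fun z : BMDPStep P A × BMDPStep P A =>
      (B.stateCost z.1.state z.2.action : ℝ≥0∞) := measurable_of_countable _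
  exact this.comp ((measurable_comp_eval n id).prodMk (measurable_comp_eval (n + 1) id))

theorem Strategy.expCost_add_expState_succ (σ : B.Strategy) (α : List P) (φ : List P → ℝ≥0∞)
    (n : ℕ) :
    σ.expCost α n + σ.expState α φ (n + 1) =
      ∫⁻ π, ∑' o, σ.choose n (Preorder.frestrictLe n π) o *
        B.stepValue φ (π n).state o ∂σ.runMeasure α := by
  rw [expCost, expState, ← lintegral_add_left (measurable_stateCost n),
    σ.lintegral_runMeasure_step α n fun β y => B.stateCost β y.action + φ y.state]
  refine lintegral_congr fun π => ?_
  rw [σ.lintegral_kernel]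
  simp_rw [mul_add, ENNReal.tsum_add, PMF.tsum_mul_const]
  rfl

theorem Strategy.expState_le_of_le_stepValue (σ : B.Strategy) (α : List P)
    {ψ φ : List P → ℝ≥0∞} (h : ∀ β, ∀ o ∈ B.enabled β, ψ β ≤ B.stepValue φ β o) (n : ℕ) :
    σ.expState α ψ n ≤ σ.expCost α n + σ.expState α φ (n + 1) := by
  rw [expCost_add_expState_succ]
  exact lintegral_mono fun π => PMF.le_tsum_mul _ fun o ho => h _ o (σ.support_subset n _ ho)

theorem Strategy.expCost_add_expState_le (σ : B.Strategy) (α : List P)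
    {ψ φ : List P → ℝ≥0∞} (n : ℕ)
    (h : ∀ (k : BMDPHistory P A n), ∀ o ∈ (σ.choose n k).support,
      B.stepValue φ k.last o ≤ ψ k.last) :
    σ.expCost α n + σ.expState α φ (n + 1) ≤ σ.expState α ψ n := by
  rw [expCost_add_expState_succ]
  exact lintegral_mono fun π => PMF.tsum_mul_le _ fun o ho => h _ o ho

theorem Strategy.expState_zero (σ : B.Strategy) (α : List P) (φ : List P → ℝ≥0∞) :
    σ.expState α φ 0 = φ α := by
  have hf : Measurable (Preorder.frestrictLe (π := fun _ : ℕ => BMDPStep P A) 0) := by fun_prop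
  have key := Kernel.traj_map_frestrictLe_apply (X := fun _ => BMDPStep P A)
    (κ := σ.kernel) 0 0 (fun _ => ⟨none, α⟩)
  have h := congrArg (fun ν => ∫⁻ z, φ (BMDPHistory.last z) ∂ν) key
  rw [lintegral_map (measurable_of_countable _) hf, Kernel.partialTraj_self, Kernel.id_apply,
    lintegral_dirac' _ (measurable_of_countable _)] at h
  exact h

theorem expTotalN_eq_sum (N : ℕ) (α : List P) (σ : B.Strategy) :
    B.expTotalN N α σ = ∑ i ∈ Finset.range N, σ.expCost α i :=
  lintegral_finsetSum _ fun i _ => measurable_stateCost i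

theorem expTotal_eq_tsum (α : List P) (σ : B.Strategy) :
    B.expTotal α σ = ∑' i, σ.expCost α i := by
  rw [ENNReal.tsum_eq_iSup_nat, expTotal]
  simp_rw [expTotalN_eq_sum]

/-! ### The lower bound for all strategies -/

theorem exists_pos_le_cost (B : BMDP P A) : ∃ c : ℝ≥0, 0 < c ∧ ∀ q a, c ≤ B.cost q a := by
  rcases isEmpty_or_nonempty (P × A) with h | h
  · exact ⟨1, one_pos, fun q a => (h.false (q, a)).elim⟩
  · obtain ⟨z, hz⟩ := Finite.exists_min fun z : P × A => B.cost z.1 z.2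
    exact ⟨_, B.cost_pos z.1 z.2, fun q a => hz (q, a)⟩

/-- Every entity present at time `n` must still be paid for or remain forever, so `m` further steps
cost at least `c * min m length`; then `m` tends to infinity. -/
theorem Strategy.mul_expState_length_le (σ : B.Strategy) (α : List P) {c : ℝ≥0}
    (hc : ∀ q a, c ≤ B.cost q a) (n : ℕ) :
    c * σ.expState α (fun β => β.length) n ≤ ∑' i, σ.expCost α (i + n) := by
  have hfin : ∀ m n, σ.expState α (fun β => c * (min m β.length : ℕ)) n ≤
      ∑ i ∈ Finset.range m, σ.expCost α (i + n) := by
    intro m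
    induction m with
    | zero => intro n; simp [expState]
    | succ m ih =>
      intro n
      refine (σ.expState_le_of_le_stepValue α
        (fun β o ho => mul_min_length_le_stepValue hc m ho) n).trans ?_
      rw [Finset.sum_range_succ', zero_add, add_comm]
      gcongr
      refine (ih (n + 1)).trans_eq (Finset.sum_congr rfl fun i _ => ?_)
      congr 1
      omega
  have hsup : ∀ l : ℕ, (c : ℝ≥0∞) * l = ⨆ m : ℕ, (c : ℝ≥0∞) * (min m l : ℕ) := by
    refine fun l => le_antisymm (le_iSup_of_le l (by simp)) (iSup_le fun m => ?_)
    gcongr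
    exact min_le_right _ _
  rw [expState, ← lintegral_const_mul _ (measurable_comp_eval n fun y => (y.state.length : ℝ≥0∞))]
  -- Monotone convergence removes the truncation.
  rw [lintegral_congr fun π => hsup _, lintegral_iSup
    (fun m => measurable_comp_eval n fun y => (c : ℝ≥0∞) * (min m y.state.length : ℕ))]
  · exact iSup_le fun m => (hfin m n).trans (ENNReal.sum_le_tsum _)
  · intro m m' hm π
    dsimp only
    gcongr

theorem Strategy.weight_le_expTotalN_add (σ : B.Strategy) (α : List P) {x : P → ℝ≥0∞}
    (hx : x ≤ B.F x) (N : ℕ) :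
    weight x α ≤ B.expTotalN N α σ + σ.expState α (weight x) N := by
  induction N with
  | zero => simp [σ.expState_zero]
  | succ N ih =>
    refine ih.trans ?_
    rw [expTotalN_eq_sum, expTotalN_eq_sum, Finset.sum_range_succ, add_assoc]
    gcongr
    exact σ.expState_le_of_le_stepValue α (fun β o ho => weight_le_stepValue hx ho) N

theorem Strategy.weight_le_expTotal (σ : B.Strategy) (α : List P) {x : P → ℝ≥0∞}
    (hx : x ≤ B.F x) (hfin : ∀ q, x q ≠ ⊤) : weight x α ≤ B.expTotal α σ := by
  by_cases htop : B.expTotal α σ = ⊤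
  · simp [htop]
  obtain ⟨c, hc0, hc⟩ := B.exists_pos_le_cost
  obtain ⟨K, hK, hxK⟩ : ∃ K : ℝ≥0∞, K ≠ ⊤ ∧ ∀ q, x q ≤ K := by
    have := Fintype.ofFinite P
    exact ⟨∑ q, x q, ENNReal.sum_ne_top.2 fun q _ => hfin q,
      fun q => Finset.single_le_sum (fun _ _ => zero_le) (Finset.mem_univ q)⟩
  have hc0' : (c : ℝ≥0∞) ≠ 0 := by simpa using hc0.ne'
  have hbound : ∀ N, weight x α ≤
      B.expTotal α σ + K * ((c : ℝ≥0∞)⁻¹ * ∑' i, σ.expCost α (i + N)) := by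
    intro N
    refine (σ.weight_le_expTotalN_add α hx N).trans (add_le_add
      (le_iSup (fun N => B.expTotalN N α σ) N) ?_)
    calc σ.expState α (weight x) N
        ≤ ∫⁻ π, K * ((π N).state.length : ℝ≥0∞) ∂σ.runMeasure α :=
          lintegral_mono fun π => weight_le_mul_length hxK _
      _ = K * σ.expState α (fun β => β.length) N :=
          lintegral_const_mul _ (measurable_comp_eval N fun y => (y.state.length : ℝ≥0∞))
      _ ≤ _ := by
          gcongr
          rw [← ENNReal.mul_le_iff_le_inv hc0' ENNReal.coe_ne_top]
          exact σ.mul_expState_length_le α hc N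
  -- The finite total makes the tails of the cost series tend to zero.
  have htail := ENNReal.tendsto_sum_nat_add (σ.expCost α) (by rwa [← expTotal_eq_tsum])
  have h1 := ENNReal.Tendsto.const_mul (a := (c : ℝ≥0∞)⁻¹) htail
    (Or.inr (ENNReal.inv_ne_top.2 hc0'))
  have h2 := (ENNReal.Tendsto.const_mul (a := K) h1 (Or.inr hK)).const_add (B.expTotal α σ)
  simpa using ge_of_tendsto' h2 hbound

/-! ### The upper bound for static strategies -/

theorem Strategy.IsStaticWith.expTotal_le {σ : B.Strategy} {f : P → A} (hσ : σ.IsStaticWith f)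
    {x : P → ℝ≥0∞} (hf : ∀ q, f q ∈ B.avail q) (hx : ∀ q, B.actionValue x q (f q) ≤ x q)
    (α : List P) : B.expTotal α σ ≤ weight x α := by
  have hstep : ∀ n, σ.expCost α n + σ.expState α (weight x) (n + 1) ≤
      σ.expState α (weight x) n := by
    refine fun n => σ.expCost_add_expState_le α n fun k o ho => ?_
    rcases hk : k.last with _ | ⟨q, β⟩
    · have hen := σ.support_subset n k ho
      rw [hk] at hen
      rcases o with _ | ⟨i, a⟩
      · rw [stepValue_none_nil]
      · obtain ⟨q, μ, hq, -⟩ := exists_of_some_mem_enabled hen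
        simp at hq
    · rw [hσ n k q β hk, PMF.support_pure, Set.mem_singleton_iff] at ho
      subst ho
      obtain ⟨μ, hμ⟩ := Option.isSome_iff_exists.1 (hf q)
      rw [stepValue_weight B x (List.getElem?_cons_zero) hμ]
      simpa using add_le_add_left (hx q) (weight x β)
  have hN : ∀ N, B.expTotalN N α σ + σ.expState α (weight x) N ≤ weight x α := by
    intro N
    induction N with
    | zero => simp [σ.expState_zero, expTotalN_eq_sum]
    | succ N ih =>
      refine le_trans ?_ ih
      rw [expTotalN_eq_sum, expTotalN_eq_sum, Finset.sum_range_succ, add_assoc]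
      gcongr
      exact hstep N
  -- The leftover weight is nonnegative and is dropped, so `x` may take the value `⊤` here.
  exact iSup_le fun N => le_self_add.trans (hN N)

end Run

/-- The static strategy that applies `f` to the first entity. -/
noncomputable def staticStrategy (B : BMDP P A) (f : P → A) (hf : ∀ q, f q ∈ B.avail q) :
    B.Strategy where
  choose n h := PMF.pure (h.last.head?.map fun q => (0, f q))
  support_subset n h := by
    rw [PMF.support_pure, Set.singleton_subset_iff]
    rcases h.last with _ | ⟨q, α⟩
    · simp [enabled, stateTrans]
    · simpa [enabled, stateTrans, avail] using hf q

theorem isStaticWith_staticStrategy (B : BMDP P A) (f : P → A) (hf : ∀ q, f q ∈ B.avail q) :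
    (B.staticStrategy f hf).IsStaticWith f := by
  intro n h q α hl
  simp [staticStrategy, hl]

/-! ### Value iteration -/

theorem actionValue_mono (B : BMDP P A) {x y : P → ℝ≥0∞} (h : x ≤ y) (q : P) (a : A) :
    B.actionValue x q a ≤ B.actionValue y q a := by
  unfold actionValue
  gcongr
  rcases B.trans q a with _ | μ
  · simp
  · exact ENNReal.tsum_le_tsum fun α => mul_le_mul_right (weight_mono h α) _

theorem F_mono (B : BMDP P A) : Monotone B.F := fun _ _ h q =>
  iInf₂_mono fun a _ => B.actionValue_mono h q a

theorem actionValue_eq_sum (B : BMDP P A) (x : P → ℝ≥0∞) {q : P} {a : A} {μ : PMF (List P)}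
    (hμ : B.trans q a = some μ) :
    B.actionValue x q a = B.cost q a +
      ∑ α ∈ (B.finite_support q a μ hμ).toFinset, μ α * weight x α := by
  rw [actionValue, hμ, Option.elim_some, tsum_eq_sum]
  · rfl
  · intro α hα
    rw [Set.Finite.mem_toFinset, PMF.mem_support_iff, not_not] at hα
    simp [hα]

theorem weight_ne_top {x : P → ℝ≥0∞} (hx : ∀ q, x q ≠ ⊤) (α : List P) : weight x α ≠ ⊤ := by
  induction α with
  | nil => simp
  | cons q α ih => simpa using ⟨hx q, ih⟩

theorem F_ne_top {B : BMDP P A} (hB : ∀ q, (B.avail q).Nonempty) {x : P → ℝ≥0∞}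
    (hx : ∀ q, x q ≠ ⊤) (q : P) : B.F x q ≠ ⊤ := by
  obtain ⟨a, ha⟩ := hB q
  obtain ⟨μ, hμ⟩ := Option.isSome_iff_exists.1 ha
  refine ne_top_of_le_ne_top ?_ (B.F_le_actionValue x ha)
  rw [B.actionValue_eq_sum x hμ]
  exact ENNReal.add_ne_top.2 ⟨ENNReal.coe_ne_top, ENNReal.sum_ne_top.2 fun α _ =>
    ENNReal.mul_ne_top (μ.apply_ne_top α) (weight_ne_top hx α)⟩

/-- Finite support makes the expectation a finite sum, which commutes with monotone suprema. -/
theorem actionValue_iSup (B : BMDP P A) {x : ℕ → P → ℝ≥0∞} (hx : Monotone x) {q : P} {a : A}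
    (ha : a ∈ B.avail q) :
    B.actionValue (fun q => ⨆ n, x n q) q a = ⨆ n, B.actionValue (x n) q a := by
  obtain ⟨μ, hμ⟩ := Option.isSome_iff_exists.1 ha
  simp_rw [B.actionValue_eq_sum _ hμ, weight_iSup hx, ENNReal.mul_iSup]
  rw [ENNReal.finsetSum_iSup_of_monotone, ENNReal.add_iSup]
  exact fun α m n h => mul_le_mul_right (weight_mono (hx h) α) _

/-- The iterates of `F` on the zero vector. -/
noncomputable def valueIter (B : BMDP P A) (n : ℕ) : P → ℝ≥0∞ := B.F^[n] 0

theorem valueIter_succ (B : BMDP P A) (n : ℕ) : B.valueIter (n + 1) = B.F (B.valueIter n) :=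
  Function.iterate_succ_apply' _ _ _

theorem valueIter_mono (B : BMDP P A) : Monotone B.valueIter :=
  B.F_mono.monotone_iterate_of_le_map fun _ => zero_le

theorem valueIter_ne_top {B : BMDP P A} (hB : ∀ q, (B.avail q).Nonempty) (n : ℕ) (q : P) :
    B.valueIter n q ≠ ⊤ := by
  induction n generalizing q with
  | zero => simp [valueIter]
  | succ n ih => rw [valueIter_succ]; exact F_ne_top hB ih q

/-- The limit of the iterates of `F` on the zero vector. -/
noncomputable def valueLim (B : BMDP P A) : P → ℝ≥0∞ := fun q => ⨆ n, B.valueIter n q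

theorem exists_actionValue_eq_F [Finite A] {B : BMDP P A} {q : P} (hB : (B.avail q).Nonempty)
    (x : P → ℝ≥0∞) : ∃ a, B.AttainsMin x q a := by
  obtain ⟨a, ha, hmin⟩ := Set.exists_min_image _ (B.actionValue x q) (Set.toFinite _) hB
  exact ⟨a, ha, le_antisymm (le_iInf₂ hmin) (B.F_le_actionValue x ha)⟩

theorem F_valueLim_le [Finite A] {B : BMDP P A} (hB : ∀ q, (B.avail q).Nonempty) :
    B.F B.valueLim ≤ B.valueLim := by
  intro q
  choose g hg using fun n => exists_actionValue_eq_F (hB q) (B.valueIter n)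
  -- Pigeonhole: one action is minimising for infinitely many iterates, so its values along them
  -- bound its value at the limit.
  obtain ⟨a, ha⟩ := Finite.exists_infinite_fiber g
  have hinf : (g ⁻¹' {a}).Infinite := Set.infinite_coe_iff.1 ha
  obtain ⟨n₀, hn₀⟩ := hinf.nonempty
  have hav : a ∈ B.avail q := by
    rw [← show g n₀ = a from hn₀]
    exact (hg n₀).1
  refine (B.F_le_actionValue _ hav).trans ?_
  unfold valueLim
  rw [B.actionValue_iSup B.valueIter_mono hav]
  refine iSup_le fun n => ?_
  obtain ⟨m, hm, hnm⟩ := hinf.exists_gt n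
  refine (B.actionValue_mono (B.valueIter_mono hnm.le) q a).trans ?_
  rw [← show g m = a from hm, (hg m).2, ← valueIter_succ]
  exact le_iSup (fun k => B.valueIter k q) (m + 1)

/-! ### Optimal costs as the limit of value iteration -/

theorem weight_valueLim_le_expTotal [Finite P] [Finite A] {B : BMDP P A}
    (hB : ∀ q, (B.avail q).Nonempty) (α : List P) (σ : B.Strategy) :
    weight B.valueLim α ≤ B.expTotal α σ := by
  unfold valueLim
  rw [weight_iSup B.valueIter_mono]
  refine iSup_le fun n => σ.weight_le_expTotal α ?_ (valueIter_ne_top hB n)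
  rw [← valueIter_succ]
  exact B.valueIter_mono n.le_succ

theorem Strategy.IsStaticWith.expTotal_eq [Finite P] [Finite A] {B : BMDP P A}
    (hB : ∀ q, (B.avail q).Nonempty) {σ : B.Strategy} {f : P → A} (hσ : σ.IsStaticWith f)
    (hf : ∀ q, B.AttainsMin B.valueLim q (f q)) (α : List P) :
    B.expTotal α σ = weight B.valueLim α :=
  le_antisymm (hσ.expTotal_le (fun q => (hf q).1)
    (fun q => (hf q).2.trans_le (F_valueLim_le hB q)) α) (weight_valueLim_le_expTotal hB α σ)

theorem optTotal_eq [Finite P] [Finite A] {B : BMDP P A} (hB : ∀ q, (B.avail q).Nonempty)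
    (α : List P) : B.optTotal α = weight B.valueLim α := by
  choose f hf using fun q => exists_actionValue_eq_F (hB q) B.valueLim
  refine le_antisymm ?_ (le_iInf fun σ => weight_valueLim_le_expTotal hB α σ)
  rw [← (B.isStaticWith_staticStrategy f fun q => (hf q).1).expTotal_eq hB hf α]
  exact iInf_le _ _

theorem optVec_eq [Finite P] [Finite A] {B : BMDP P A} (hB : ∀ q, (B.avail q).Nonempty) :
    B.optVec = B.valueLim := by
  ext q
  simp [optVec, optTotal_eq hB]

end BMDP

/-- In a BMDP with positive costs in which every type has an available action, there is an optimal
static strategy, which picks for each type an action attaining the minimum in `F` at `c*`; and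
every static strategy that picks such actions is optimal. -/
theorem mainTheorem6 {P A : Type*} [Finite P] [Finite A] (B : BMDP P A)
    (hB : ∀ q, (B.avail q).Nonempty) :
    (∃ (σ : B.Strategy) (f : P → A), σ.IsStaticWith f ∧
      (∀ q, B.AttainsMin B.optVec q (f q)) ∧ σ.IsOptimal) ∧
    (∀ (σ : B.Strategy) (f : P → A), σ.IsStaticWith f →
      (∀ q, B.AttainsMin B.optVec q (f q)) → σ.IsOptimal) := by
  have hopt : ∀ (σ : B.Strategy) (f : P → A), σ.IsStaticWith f →
      (∀ q, B.AttainsMin B.optVec q (f q)) → σ.IsOptimal := by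
    intro σ f hσ hf α
    -- Minimising at `c*` is minimising at `valueLim`, where both bounds meet.
    rw [BMDP.optVec_eq hB] at hf
    rw [hσ.expTotal_eq hB hf, BMDP.optTotal_eq hB]
  choose f hf using fun q => BMDP.exists_actionValue_eq_F (hB q) B.optVec
  have hσ := B.isStaticWith_staticStrategy f fun q => (hf q).1
  exact ⟨⟨_, f, hσ, hf, hopt _ f hσ hf⟩, hopt⟩
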